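/- **Setting.** Fix a universe; sets are small sets and $\mathbf{Set}$ is their category. A (many-sorted) *signature* $\Sigma=(S,\Sigma)$ consists of a set $S$ of sorts and sets $\Sigma_{w,s}$ of operation symbols ($w\in S^\star$, $s\in S$). For an $S$-sorted set $A$ and a word $w$ put $A_w=\prod_{i<|w|}A_{w_i}$; let ${\downarrow}w$ be the $S$-sorted set of variables with $({\downarrow}w)_s=\{v_i : i<|w|,\ w_i=s\}$. $\mathbf{Alg}(\Sigma)$ is the category of $\Sigma$-algebras and homomorphisms, $T_\Sigma(X)$ the free $\Sigma$-algebra (of terms) on $X$, and $u^\sharp:T_\Sigma(X)\to A$ the homomorphic extension of $u:X\to A$. $\mathbf{Ter}(\Sigma)$ is the category whose objects are the $S$-sorted sets, whose morphisms $P:X\to Y$ are the $S$-sorted mappings $P:Y\to T_\Sigma(X)$, and whose composition is substitution. *Term realization* is the functor $\mathrm{Tr}^\Sigma:\mathbf{Alg}(\Sigma)\times\mathbf{Ter}(\Sigma)\to\mathbf{Set}$, $(\mathbf A,X)\mapsto\mathrm{Hom}(X,A)$, which sends $(f,P):(\mathbf A,X)\to(\mathbf B,Y)$ to $u\mapsto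 f\circ u^\sharp\circ P$. **Polyderivors.** A *polyderivor* $\mathbf d=(\varphi,d):(S,\Sigma)\to(T,\Lambda)$ consists of a mapping $\varphi:S\to T^\star$, with extension $\varphi^\sharp:S^\star\to T^\star$ to a homomorphism of monoids, and, for all $(w,s)$, a mapping $d_{w,s}:\Sigma_{w,s}\to T_\Lambda({\downarrow}\varphi^\sharp(w))_{\varphi(s)}$. For a $\Lambda$-algebra $\mathbf B$ let $\mathbf d^*(\mathbf B)$ be the $\Sigma$-algebra on $B_\varphi=(B_{\varphi(s)})_{s\in S}$ in which $\sigma\in\Sigma_{w,s}$ acts as $\prod_i B_{\varphi(w_i)}\cong B_{\varphi^\sharp(w)}\to B_{\varphi(s)}$, the second mapping being the realization in $\mathbf B$ of the family of terms $d(\sigma)$; with $f\mapsto f_\varphi$ this is a functor $\mathbf d^*:\mathbf{Alg}(\Lambda)\to\mathbf{Alg}(\Sigma)$. For an $S$-sorted set $X$ let $(\coprod^\dagger_\varphi X)_t=\{(s,x,j): s\in S,\ x\in X_s,\ j\in({\downarrow}\varphi(s))_t\}$, and let $$\theta_{X,B}:\mathrm{Hom}(\textstyle\coprod^\dagger_\varphi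 X,B)\to\mathrm{Hom}(X,B_\varphi),\qquad \theta_{X,B}(h)_s(x)=\big(h(s,x,j)\big)_j,$$ be the canonical bijection. The homomorphism $\eta^{\mathbf d}_X:T_\Sigma(X)\to\mathbf d^*(T_\Lambda(\coprod^\dagger_\varphi X))$ is the one that extends $\theta$ of the insertion of the variables, and $\mathbf d_\diamond:\mathbf{Ter}(\Sigma)\to\mathbf{Ter}(\Lambda)$ is the functor $X\mapsto\coprod^\dagger_\varphi X$, $P\mapsto\theta^{-1}(\eta^{\mathbf d}_X\circ P)$. The composite of $\mathbf d$ with $\mathbf e=(\psi,e):\Lambda\to\Omega$ has sort mapping $\psi^\sharp\circ\varphi$ and sends $\sigma$ to the result of replacing in $d(\sigma)$ every variable by its block of variables and every operation symbol by its image under $e$; the identity sends $s$ to $(s)$ and $\sigma$ to $\sigma(v_0,\dots,v_{|w|-1})$. Signatures and polyderivors form a category $\mathbf{Sig}_{\mathfrak{pd}}$. The assignments $\Sigma\mapsto\mathbf{Alg}(\Sigma)$, $\mathbf d\mapsto\mathbf d^*$ and $\Sigma\mapsto\mathbf{Ter}(\Sigma)$, $\mathbf d\mapsto\mathbf d_\diamond$,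 with the natural isomorphisms induced by $\prod_iB_{\psi(w_i)}\cong B_{\psi^\sharp(w)}$, $A_s\cong A_{(s)}$, $\coprod^\dagger_\psi\coprod^\dagger_\varphi X\cong\coprod^\dagger_{\psi^\sharp\circ\varphi}X$ and $X\cong\coprod^\dagger_{s\mapsto(s)}X$, are pseudo-functors $\mathrm{Alg}_{\mathfrak{pd}}:\mathbf{Sig}_{\mathfrak{pd}}^{\mathrm{op}}\to\mathbf{Cat}$ and $\mathrm{Ter}_{\mathfrak{pd}}:\mathbf{Sig}_{\mathfrak{pd}}\to\mathbf{Cat}$. **Pseudo-extranaturality and institutions.** Let $\mathbf C$ be an ordinary category, $F:\mathbf C^{\mathrm{op}}\times\mathbf C\to\mathbf{Cat}$ a pseudo-functor and $\mathbf V$ a category. A *pseudo-extranatural transformation* from $F$ to the functor $\mathrm K_{\mathbf V}$ constantly $\mathbf V$ is a family of functors $\alpha_c:F(c,c)\to\mathbf V$ together with natural isomorphisms $\beta_f:\alpha_c\circ F(f,1)\Rightarrow\alpha_{c'}\circ F(1,f)$, for $f:c\to c'$, such that $\beta_{1_c}$ is the identity and, for $f:c\to c'$ and $g:c'\to c''$,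 up to the structural isomorphisms of $F$, $(\beta_g*F(1,f))\circ(\beta_f*F(g,1))=\beta_{g\circ f}$. An *institution on $\mathbf V$* is a quadruple $(\mathbf{Sig},\mathrm{Mod},\mathrm{Sen},(\alpha,\beta))$ with $\mathbf{Sig}$ a category, $\mathrm{Mod}:\mathbf{Sig}^{\mathrm{op}}\to\mathbf{Cat}$ and $\mathrm{Sen}:\mathbf{Sig}\to\mathbf{Cat}$ pseudo-functors, and $(\alpha,\beta)$ a pseudo-extranatural transformation from $\mathrm{Mod}(\cdot)\times\mathrm{Sen}(\cdot)$ to $\mathrm K_{\mathbf V}$. **Statement.** 1. The pseudo-functors $\mathrm{Alg}_{\mathfrak{pd}}$ and $\mathrm{Ter}_{\mathfrak{pd}}$ give a pseudo-functor $\mathrm{Alg}_{\mathfrak{pd}}(\cdot)\times\mathrm{Ter}_{\mathfrak{pd}}(\cdot):\mathbf{Sig}_{\mathfrak{pd}}^{\mathrm{op}}\times\mathbf{Sig}_{\mathfrak{pd}}\to\mathbf{Cat}$ which sends $(\Sigma,\Lambda)$ to $\mathbf{Alg}(\Sigma)\times\mathbf{Ter}(\Lambda)$ and $(\mathbf d,\mathbf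 e)$ to $\mathbf d^*\times\mathbf e_\diamond$. 2. For every polyderivor $\mathbf d:\Sigma\to\Lambda$, the bijections $\theta^{\mathbf d}_{\mathbf A,X}=\theta_{X,A}$, for $\mathbf A\in\mathbf{Alg}(\Lambda)$ and $X\in\mathbf{Ter}(\Sigma)$, are the components of a natural isomorphism $\theta^{\mathbf d}$ from $\mathrm{Tr}^\Lambda\circ(\mathrm{Id}\times\mathbf d_\diamond)$ to $\mathrm{Tr}^\Sigma\circ(\mathbf d^*\times\mathrm{Id})$, i.e. term realization is invariant under polyderivors. Moreover $(\mathrm{Tr},\theta)$ is a pseudo-extranatural transformation from $\mathrm{Alg}_{\mathfrak{pd}}(\cdot)\times\mathrm{Ter}_{\mathfrak{pd}}(\cdot)$ to $\mathrm K_{\mathbf{Set}}$; here $\alpha_\Sigma=\mathrm{Tr}^\Sigma$, and $\beta_{\mathbf d}:\mathrm{Tr}^\Sigma\circ(\mathbf d^*\times\mathrm{id}_\diamond)\Rightarrow\mathrm{Tr}^\Lambda\circ(\mathrm{id}^*\times\mathbf d_\diamond)$ is $(\theta^{\mathbf d})^{-1}$ composed with the structural isomorphisms $\mathrm{id}_\diamond\cong\mathrm{Id}$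 and $\mathrm{id}^*\cong\mathrm{Id}$. 3. Consequently $(\mathbf{Sig}_{\mathfrak{pd}},\mathrm{Alg}_{\mathfrak{pd}},\mathrm{Ter}_{\mathfrak{pd}},(\mathrm{Tr},\theta))$ is an institution on $\mathbf{Set}$. -/

import Mathlib

open CategoryTheory
open scoped Bicategory

universe u

namespace ManySorted

/-- `(↓w)_s`: the finite sorted set of variables attached to a word `w`. Its elements of sort `s`
are the variables `v_n` such that the `n`-th letter of `w` is `s`. -/
@[ext]
structure Down {S : Type u} (w : List S) (s : S) : Type u where
  /-- the index of the variable -/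
  val : ℕ
  /-- the letter at this index is `s` -/
  property : w[val]? = some s

/-- `A_w`, the product of the `A_{w_n}` over the positions `n` of the word `w`. A member assigns an
element of `A_s` to every position of `w` that is occupied by `s`
(see `powEquiv` for the description as a product over `Fin w.length`). -/
abbrev Pow {S : Type u} (A : S → Type u) (w : List S) : Type u :=
  ∀ s, Down w s → A s

section Words

variable {S T : Type u}

/-- `A_w` is the product of the `A_{w_n}` with `n < |w|`. -/
def powEquiv (A : S → Type u) (l : List S) : Pow A l ≃ ∀ i : Fin l.length, A l[i] where
  toFun a i := a l[i] ⟨i, by simp⟩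
  invFun b s n := (List.getElem?_eq_some_iff.1 n.2).2 ▸
    b ⟨n.1, (List.getElem?_eq_some_iff.1 n.2).1⟩
  left_inv a := by
    funext s n
    obtain ⟨n, hn⟩ := n
    obtain ⟨h, rfl⟩ := List.getElem?_eq_some_iff.1 hn
    rfl
  right_inv b := rfl

/-- Relabelling of variables along an equality of words. -/
def Down.cast {w w' : List S} (h : w = w') {s : S} (i : Down w s) : Down w' s :=
  ⟨i.1, h ▸ i.2⟩

@[simp] theorem Down.cast_val {w w' : List S} (h : w = w') {s : S} (i : Down w s) :
    (Down.cast h i).1 = i.1 := rfl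

/-- The only variable of the one-letter word `(s)`. -/
def Down.here (s : S) : Down [s] s := ⟨0, rfl⟩

theorem Down.singleton {s t : S} (i : Down [s] t) :
    ∃ h : s = t, i = h ▸ Down.here s := by
  obtain ⟨n, hn⟩ := i
  cases n with
  | zero =>
    have : s = t := by simpa using hn
    subst this
    exact ⟨rfl, rfl⟩
  | succ n => simp at hn

/-- The length of the part of `φ♯(w)` that comes from the first `n` letters of `w`. -/
def offset (φ : S → List T) (w : List S) (n : ℕ) : ℕ := ((w.take n).flatMap φ).length

theorem offset_cons_succ (φ : S → List T) (s : S) (w : List S) (n : ℕ) :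
    offset φ (s :: w) (n + 1) = (φ s).length + offset φ w n := by
  simp [offset]

@[simp] theorem offset_zero (φ : S → List T) (w : List S) : offset φ w 0 = 0 := by
  simp [offset]

theorem join_aux (φ : S → List T) {s : S} {t : T} : ∀ (w : List S) (n j : ℕ),
    w[n]? = some s → (φ s)[j]? = some t → (w.flatMap φ)[offset φ w n + j]? = some t
  | [], n, j, h, _ => by simp at h
  | a :: w, 0, j, h, h' => by
    have : a = s := by simpa using h
    subst this
    have := (List.getElem?_eq_some_iff.1 h').1
    simp [List.getElem?_append_left this, h']
  | a :: w, n + 1, j, h, h' => by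
    have h1 : w[n]? = some s := by simpa using h
    have := join_aux φ w n j h1 h'
    rw [offset_cons_succ, List.flatMap_cons, List.getElem?_append_right (by omega)]
    convert this using 2
    omega

/-- The `j`-th variable of the block of `φ♯(w)` which corresponds to the `i`-th letter of `w`. -/
def join (φ : S → List T) {w : List S} {s : S} {t : T} (i : Down w s) (j : Down (φ s) t) :
    Down (w.flatMap φ) t :=
  ⟨offset φ w i.1 + j.1, join_aux φ w i.1 j.1 i.2 j.2⟩

theorem join_surj_aux (φ : S → List T) {t : T} : ∀ (w : List S) (k : ℕ),
    (w.flatMap φ)[k]? = some t →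
      ∃ s n j, w[n]? = some s ∧ (φ s)[j]? = some t ∧ offset φ w n + j = k
  | [], k, h => by simp at h
  | a :: w, k, h => by
    rw [List.flatMap_cons] at h
    by_cases hk : k < (φ a).length
    · rw [List.getElem?_append_left hk] at h
      exact ⟨a, 0, k, by simp, h, by simp⟩
    · rw [List.getElem?_append_right (by omega)] at h
      obtain ⟨s, n, j, h1, h2, h3⟩ := join_surj_aux φ w _ h
      exact ⟨s, n + 1, j, by simpa using h1, h2, by rw [offset_cons_succ]; omega⟩

theorem join_inj_aux (φ : S → List T) {s s' : S} {t t' : T} : ∀ (w : List S) (n n' j j' : ℕ),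
    w[n]? = some s → w[n']? = some s' → (φ s)[j]? = some t → (φ s')[j']? = some t' →
      offset φ w n + j = offset φ w n' + j' → n = n' ∧ j = j'
  | [], n, _, _, _, h, _, _, _, _ => by simp at h
  | a :: w, 0, 0, j, j', h, h', h1, h2, e => by simpa using e
  | a :: w, 0, n + 1, j, j', h, h', h1, h2, e => by
    have : a = s := by simpa using h
    subst this
    have := (List.getElem?_eq_some_iff.1 h1).1
    rw [offset_cons_succ] at e
    simp at e
    omega
  | a :: w, n + 1, 0, j, j', h, h', h1, h2, e => by
    have : a = s' := by simpa using h'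
    subst this
    have := (List.getElem?_eq_some_iff.1 h2).1
    rw [offset_cons_succ] at e
    simp at e
    omega
  | a :: w, n + 1, n' + 1, j, j', h, h', h1, h2, e => by
    rw [offset_cons_succ, offset_cons_succ] at e
    have := join_inj_aux φ w n n' j j' (by simpa using h) (by simpa using h') h1 h2 (by omega)
    omega

theorem join_bijective (φ : S → List T) (w : List S) (t : T) :
    Function.Bijective
      (fun p : Σ s, Down w s × Down (φ s) t => join φ p.2.1 p.2.2) := by
  constructor
  · rintro ⟨s, i, j⟩ ⟨s', i', j'⟩ h
    have h1 := join_inj_aux φ w i.1 i'.1 j.1 j'.1 i.2 i'.2 j.2 j'.2 (congrArg Down.val h)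
    have hs : s = s' := by
      have := i.2
      rw [h1.1, i'.2] at this
      exact (Option.some.inj this).symm
    subst hs
    have h2 : i = i' := Down.ext h1.1
    have h3 : j = j' := Down.ext h1.2
    rw [h2, h3]
  · rintro ⟨k, hk⟩
    obtain ⟨s, n, j, h1, h2, h3⟩ := join_surj_aux φ w k hk
    exact ⟨⟨s, ⟨n, h1⟩, ⟨j, h2⟩⟩, Down.ext h3⟩

/-- A variable of `φ♯(w)` is given by a letter of `w` and a variable of the corresponding block. -/
noncomputable def joinEquiv (φ : S → List T) (w : List S) (t : T) :
    (Σ s, Down w s × Down (φ s) t) ≃ Down (w.flatMap φ) t :=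
  Equiv.ofBijective _ (join_bijective φ w t)

/-- The bijection `ι` from `∏_i B_{φ(w_i)}` to `B_{φ♯(w)}`. -/
noncomputable def flatten (φ : S → List T) {B : T → Type u} {w : List S}
    (a : Pow (fun s => Pow B (φ s)) w) : Pow B (w.flatMap φ) :=
  fun t v =>
    let p := (joinEquiv φ w t).symm v
    a p.1 p.2.1 t p.2.2

@[simp] theorem flatten_join (φ : S → List T) {B : T → Type u} {w : List S}
    (a : Pow (fun s => Pow B (φ s)) w) {s : S} {t : T} (i : Down w s) (j : Down (φ s) t) :
    flatten φ a t (join φ i j) = a s i t j := by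
  have : (joinEquiv φ w t).symm (join φ i j) = ⟨s, i, j⟩ :=
    (Equiv.symm_apply_eq _).2 rfl
  show (fun p : Σ s, Down w s × Down (φ s) t => a p.1 p.2.1 t p.2.2)
    ((joinEquiv φ w t).symm (join φ i j)) = _
  rw [this]

theorem exists_join (φ : S → List T) {w : List S} {t : T} (v : Down (w.flatMap φ) t) :
    ∃ (s : S) (i : Down w s) (j : Down (φ s) t), v = join φ i j := by
  obtain ⟨⟨s, i, j⟩, rfl⟩ := (joinEquiv φ w t).surjective v
  exact ⟨s, i, j, rfl⟩

/-- Two members of `B_{φ♯(w)}` with the same blocks are equal. -/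
theorem pow_flatMap_ext (φ : S → List T) {B : T → Type u} {w : List S}
    {a b : Pow B (w.flatMap φ)}
    (h : ∀ s (i : Down w s) t (j : Down (φ s) t), a t (join φ i j) = b t (join φ i j)) :
    a = b := by
  funext t v
  obtain ⟨s, i, j, rfl⟩ := exists_join φ v
  exact h s i t j

theorem offset_join {U : Type u} (φ : S → List T) (ψ : T → List U) {s : S} {t : T} :
    ∀ (w : List S) (n j : ℕ), w[n]? = some s → (φ s)[j]? = some t →
      offset ψ (w.flatMap φ) (offset φ w n + j) =
        offset (fun s => (φ s).flatMap ψ) w n + offset ψ (φ s) j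
  | [], n, j, h, _ => by simp at h
  | a :: w, 0, j, h, h' => by
    have : a = s := by simpa using h
    subst this
    have := (List.getElem?_eq_some_iff.1 h').1
    simp [offset, List.take_append_of_le_length this.le]
  | a :: w, n + 1, j, h, h' => by
    have := offset_join φ ψ w n j (by simpa using h) h'
    rw [offset_cons_succ, offset_cons_succ, List.flatMap_cons, add_assoc, add_assoc, ← this]
    simp only [offset, List.take_append, List.flatMap_append, List.length_append]
    rw [List.take_of_length_le (by omega)]
    congr 4
    omega

theorem join_assoc {U : Type u} (φ : S → List T) (ψ : T → List U) {w : List S} {s : S} {t : T}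
    {x : U} (i : Down w s) (j : Down (φ s) t) (k : Down (ψ t) x) :
    Down.cast List.flatMap_assoc (join ψ (join φ i j) k) =
      join (fun s => (φ s).flatMap ψ) i (join ψ j k) := by
  apply Down.ext
  simp only [Down.cast_val, join, offset_join φ ψ w i.1 j.1 i.2 j.2, add_assoc]

theorem offset_singleton : ∀ (w : List S) (n : ℕ), n ≤ w.length →
    offset (fun s : S => [s]) w n = n
  | w, 0, _ => by simp
  | [], n + 1, h => by simp at h
  | a :: w, n + 1, h => by
    rw [offset_cons_succ, offset_singleton w n (by simpa using h)]
    simp [add_comm]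

theorem flatMap_singletons (w : List S) : w.flatMap (fun s => [s]) = w := by
  simp

theorem flatMap_one (φ : S → List T) (s : S) : [s].flatMap φ = φ s := by simp

theorem join_here (φ : S → List T) {s : S} {t : T} (j : Down (φ s) t) :
    Down.cast (flatMap_one φ s) (join φ (Down.here s) j) = j := by
  apply Down.ext
  simp [join, Down.here]

theorem join_singletons {w : List S} {s : S} (i : Down w s) :
    Down.cast (flatMap_singletons w) (join (fun s => [s]) i (Down.here s)) = i := by
  apply Down.ext
  have := (List.getElem?_eq_some_iff.1 i.2).1
  simp [join, Down.here, offset_singleton w i.1 this.le]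

theorem Down.cast_cast {w₁ w₂ w₃ : List S} (h : w₁ = w₂) (h' : w₂ = w₃) {s : S}
    (i : Down w₁ s) : Down.cast h' (Down.cast h i) = Down.cast (h.trans h') i := rfl

theorem join_cast (φ : S → List T) {w w' : List S} (h : w = w') {s : S} {t : T} (i : Down w s)
    (j : Down (φ s) t) : join φ (Down.cast h i) j = Down.cast (by rw [h]) (join φ i j) := by
  subst h
  rfl

/-- Blockwise form of a nested `flatten`. -/
theorem flatten_flatten {U : Type u} (φ : S → List T) (ψ : T → List U) {C : U → Type u}
    {w : List S} (a : Pow (fun s => Pow (fun t => Pow C (ψ t)) (φ s)) w) :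
    flatten ψ (flatten φ a) = fun x v =>
      flatten (fun s => (φ s).flatMap ψ) (fun s i => flatten ψ (a s i)) x
        (Down.cast List.flatMap_assoc v) := by
  apply pow_flatMap_ext
  intro t v x k
  obtain ⟨s, i, j, rfl⟩ := exists_join φ v
  simp [join_assoc]

theorem flatten_comp (φ : S → List T) {B C : T → Type u} (f : ∀ t, B t → C t) {w : List S}
    (a : Pow (fun s => Pow B (φ s)) w) :
    (fun t v => f t (flatten φ a t v)) = flatten φ (fun s i t j => f t (a s i t j)) := by
  apply pow_flatMap_ext
  intro s i t j
  simp

/-- The bijection `ι` from `∏_i B_{φ(w_i)}` to `B_{φ♯(w)}`, as an equivalence. -/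
noncomputable def flattenEquiv (φ : S → List T) (B : T → Type u) (w : List S) :
    Pow (fun s => Pow B (φ s)) w ≃ Pow B (w.flatMap φ) where
  toFun := flatten φ
  invFun b s i t j := b t (join φ i j)
  left_inv a := by funext s i t j; simp
  right_inv b := pow_flatMap_ext φ (by intros; simp)

/-- The member of `A_{(s)}` given by an element of `A_s`. -/
def single {A : S → Type u} {s : S} (a : A s) : Pow A [s] :=
  fun _ i => i.singleton.choose ▸ a

@[simp] theorem single_here {A : S → Type u} {s : S} (a : A s) :
    single a s (Down.here s) = a := rfl

theorem pow_singleton_ext {A : S → Type u} {s : S} {a b : Pow A [s]}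
    (h : a s (Down.here s) = b s (Down.here s)) : a = b := by
  funext t i
  obtain ⟨e, h'⟩ := i.singleton
  subst e h'
  exact h

/-- The canonical bijection between `A_s` and `A_{(s)}`. -/
def singleEquiv (A : S → Type u) (s : S) : A s ≃ Pow A [s] where
  toFun := single
  invFun a := a s (Down.here s)
  left_inv _ := rfl
  right_inv _ := pow_singleton_ext rfl

end Words

/-- A many-sorted signature: a set of sorts `S` and, for every word `w` on `S` and every sort `s`,
a set of operation symbols of arity `w` and coarity `s`. -/
structure Signature where
  /-- the sorts -/
  sorts : Type u
  /-- the operation symbols of given arity and coarity -/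
  Op : List sorts → sorts → Type u

/-- The terms with variables in the sorted set `X`, i.e. the underlying sorted set of the free
algebra on `X`. -/
inductive Term (Sg : Signature.{u}) (X : Sg.sorts → Type u) : Sg.sorts → Type u
  /-- a variable -/
  | var {s : Sg.sorts} (x : X s) : Term Sg X s
  /-- an operation symbol applied to a family of terms -/
  | op {w : List Sg.sorts} {s : Sg.sorts} (σ : Sg.Op w s)
      (a : ∀ t, Down w t → Term Sg X t) : Term Sg X s

/-- A many-sorted algebra. -/
structure Alg (Sg : Signature.{u}) where
  /-- the underlying sorted set -/
  carrier : Sg.sorts → Type u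
  /-- the structural operations -/
  op : ∀ {w : List Sg.sorts} {s : Sg.sorts}, Sg.Op w s → Pow carrier w → carrier s

/-- A homomorphism of many-sorted algebras. -/
@[ext]
structure AlgHom {Sg : Signature.{u}} (A B : Alg Sg) where
  /-- the underlying sorted mapping -/
  toFun : ∀ s, A.carrier s → B.carrier s
  map_op : ∀ {w : List Sg.sorts} {s : Sg.sorts} (σ : Sg.Op w s) (a : Pow A.carrier w),
    toFun s (A.op σ a) = B.op σ (fun t i => toFun t (a t i))

/-- The category of algebras for a signature. -/
instance algCategory (Sg : Signature.{u}) : Category.{u} (Alg Sg) where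
  Hom := AlgHom
  id A := ⟨fun _ a => a, fun _ _ => rfl⟩
  comp f g := ⟨fun s a => g.toFun s (f.toFun s a), fun σ a => by rw [f.map_op, g.map_op]⟩

theorem alg_hom_ext {Sg : Signature.{u}} {A B : Alg Sg} {f g : A ⟶ B}
    (h : ∀ s a, f.toFun s a = g.toFun s a) : f = g :=
  AlgHom.ext (funext fun s => funext fun a => h s a)

@[simp] theorem alg_id_toFun {Sg : Signature.{u}} (A : Alg Sg) (s : Sg.sorts) (a : A.carrier s) :
    AlgHom.toFun (𝟙 A) s a = a := rfl

@[simp] theorem alg_comp_toFun {Sg : Signature.{u}} {A B C : Alg Sg} (f : A ⟶ B) (g : B ⟶ C)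
    (s : Sg.sorts) (a : A.carrier s) :
    (f ≫ g).toFun s a = AlgHom.toFun g s (AlgHom.toFun f s a) := rfl

/-- An isomorphism of algebras from a bijective homomorphism. -/
def Alg.isoMk {Sg : Signature.{u}} {A B : Alg Sg} (f : A ⟶ B)
    (e : ∀ s, A.carrier s ≃ B.carrier s) (h : ∀ s a, f.toFun s a = e s a) : A ≅ B where
  hom := f
  inv := ⟨fun s => (e s).symm, fun {w s} σ b => by
    rw [Equiv.symm_apply_eq, ← h, f.map_op]
    simp [h]⟩
  hom_inv_id := alg_hom_ext fun s a => by
    show (e s).symm (f.toFun s a) = a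
    simp [h]
  inv_hom_id := alg_hom_ext fun s a => by
    show f.toFun s ((e s).symm a) = a
    simp [h]

/-- The free algebra `T_Σ(X)`. -/
abbrev Alg.free (Sg : Signature.{u}) (X : Sg.sorts → Type u) : Alg Sg where
  carrier := Term Sg X
  op := Term.op

/-- The canonical extension `f♯` of a valuation `f` of the variables in an algebra. -/
def Term.eval {Sg : Signature.{u}} {X : Sg.sorts → Type u} (A : Alg Sg)
    (f : ∀ s, X s → A.carrier s) : ∀ {s : Sg.sorts}, Term Sg X s → A.carrier s
  | _, .var x => f _ x
  | _, .op σ a => A.op σ (fun t i => (a t i).eval A f)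

/-- Substitution of terms for the variables of a term. -/
def Term.bind {Sg : Signature.{u}} {X Y : Sg.sorts → Type u} {s : Sg.sorts} (P : Term Sg X s)
    (f : ∀ s, X s → Term Sg Y s) : Term Sg Y s :=
  P.eval (Alg.free Sg Y) f

/-- Renaming of the variables of a term. -/
def Term.rename {Sg : Signature.{u}} {X Y : Sg.sorts → Type u} (f : ∀ s, X s → Y s)
    {s : Sg.sorts} (P : Term Sg X s) : Term Sg Y s :=
  P.bind (fun s x => .var (f s x))

section Terms

variable {Sg : Signature.{u}} {X Y Z : Sg.sorts → Type u}

@[simp] theorem eval_var (A : Alg Sg) (f : ∀ s, X s → A.carrier s) {s : Sg.sorts} (x : X s) :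
    (Term.var x).eval A f = f s x := rfl

theorem eval_op (A : Alg Sg) (f : ∀ s, X s → A.carrier s) {w : List Sg.sorts} {s : Sg.sorts}
    (σ : Sg.Op w s) (a : ∀ t, Down w t → Term Sg X t) :
    (Term.op σ a).eval A f = A.op σ (fun t i => (a t i).eval A f) := rfl

/-- The extension of a valuation as a homomorphism. -/
def evalHom (A : Alg Sg) (f : ∀ s, X s → A.carrier s) : Alg.free Sg X ⟶ A where
  toFun _ P := P.eval A f
  map_op _ _ := rfl

theorem hom_eval {A B : Alg Sg} (h : A ⟶ B) (f : ∀ s, X s → A.carrier s) {s : Sg.sorts}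
    (P : Term Sg X s) : h.toFun s (P.eval A f) = P.eval B (fun s x => h.toFun s (f s x)) := by
  induction P with
  | var x => rfl
  | op σ a ih =>
    rw [eval_op, h.map_op, eval_op]
    simp only [ih]

theorem eval_bind (A : Alg Sg) (f : ∀ s, Y s → A.carrier s) (g : ∀ s, X s → Term Sg Y s)
    {s : Sg.sorts} (P : Term Sg X s) :
    (P.bind g).eval A f = P.eval A (fun s x => (g s x).eval A f) :=
  hom_eval (evalHom A f) g P

theorem eval_rename (A : Alg Sg) (f : ∀ s, Y s → A.carrier s) (g : ∀ s, X s → Y s)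
    {s : Sg.sorts} (P : Term Sg X s) :
    (P.rename g).eval A f = P.eval A (fun s x => f s (g s x)) :=
  eval_bind A f _ P

theorem eval_free_var {s : Sg.sorts} (P : Term Sg X s) :
    P.eval (Alg.free Sg X) (fun _ x => .var x) = P := by
  induction P with
  | var x => rfl
  | op σ a ih =>
    rw [eval_op]
    simp only [ih]

theorem rename_id {s : Sg.sorts} (P : Term Sg X s) : P.rename (fun _ x => x) = P :=
  eval_free_var P

theorem rename_rename (f : ∀ s, X s → Y s) (g : ∀ s, Y s → Z s) {s : Sg.sorts}
    (P : Term Sg X s) : (P.rename f).rename g = P.rename (fun s x => g s (f s x)) :=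
  eval_rename _ _ _ P

end Terms

/-- A polyderivor from `Σ` to `Λ`: a mapping `φ` from the sorts of `Σ` to the words on the sorts of
`Λ` and, for every operation symbol `σ : w → s` of `Σ`, a family of terms of `Λ` of type
`φ(s)`, with variables in `↓φ♯(w)`, where `φ♯` is the extension of `φ` to the free monoids. -/
structure Polyderivor (Sg Lm : Signature.{u}) where
  /-- the mapping on sorts -/
  onSort : Sg.sorts → List Lm.sorts
  /-- the mapping on operation symbols -/
  onOp : ∀ {w : List Sg.sorts} {s : Sg.sorts}, Sg.Op w s →
    Pow (Term Lm (Down (w.flatMap onSort))) (onSort s)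

namespace Polyderivor

variable {Sg Lm Om Th : Signature.{u}}

theorem ext' {d e : Polyderivor Sg Lm} (h : ∀ s, d.onSort s = e.onSort s)
    (h' : ∀ {w : List Sg.sorts} {s : Sg.sorts} (σ : Sg.Op w s) (t : Lm.sorts)
      (j : Down (d.onSort s) t),
      (d.onOp σ t j).rename (fun _ => Down.cast (by rw [funext h])) =
        e.onOp σ t (Down.cast (h s) j)) : d = e := by
  obtain ⟨φ, p⟩ := d
  obtain ⟨ψ, q⟩ := e
  obtain rfl : φ = ψ := funext h
  congr 1
  funext w s σ t j
  exact (rename_id _).symm.trans (h' σ t j)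

/-- The algebra `d*(B)`: its underlying sorted set is `(B_{φ(s)})_s`, and an operation symbol `σ`
of arity `w` is realized as the composition of the isomorphism `ι` from `∏_i B_{φ(w_i)}` to
`B_{φ♯(w)}` and the realization of the terms `d(σ)`. -/
noncomputable abbrev pullAlg (d : Polyderivor Sg Lm) (B : Alg Lm) : Alg Sg where
  carrier s := Pow B.carrier (d.onSort s)
  op σ a := fun t j => (d.onOp σ t j).eval B (flatten d.onSort a)

/-- The action of `d*` on homomorphisms. -/
noncomputable def pullMap (d : Polyderivor Sg Lm) {B C : Alg Lm} (f : B ⟶ C) :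
    d.pullAlg B ⟶ d.pullAlg C where
  toFun _ a := fun t j => f.toFun t (a t j)
  map_op σ a := by
    funext t j
    show f.toFun t ((d.onOp σ t j).eval B (flatten d.onSort a)) =
      (d.onOp σ t j).eval C (flatten d.onSort _)
    rw [hom_eval, flatten_comp]

/-- The functor `d*` from the algebras of `Λ` to the algebras of `Σ`. -/
noncomputable def pull (d : Polyderivor Sg Lm) : Alg Lm ⥤ Alg Sg where
  obj := d.pullAlg
  map := d.pullMap

/-- The derived mapping `d♯` from the terms of `Σ` with variables in `↓u` to the families of terms
of `Λ` with variables in `↓φ♯(u)`. It sends the variable in position `i` of `u` to the `i`-th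
block of variables, and it commutes with the operations. -/
noncomputable def sharp (d : Polyderivor Sg Lm) (u : List Sg.sorts) {s : Sg.sorts}
    (P : Term Sg (Down u) s) : Pow (Term Lm (Down (u.flatMap d.onSort))) (d.onSort s) :=
  P.eval (d.pullAlg (Alg.free Lm (Down (u.flatMap d.onSort))))
    (fun _ i _ j => .var (join d.onSort i j))

/-- The identity polyderivor: `s` goes to `(s)`, and `σ` to the term `σ(v_0, …, v_{|w|-1})`. -/
abbrev idPd (Sg : Signature.{u}) : Polyderivor Sg Sg where
  onSort s := [s]
  onOp {w _} σ :=
    single (.op σ (fun _ i => .var (Down.cast (flatMap_singletons w).symm i)))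

/-- The composition of the polyderivors `d` and `e`. -/
noncomputable abbrev comp (d : Polyderivor Sg Lm) (e : Polyderivor Lm Om) : Polyderivor Sg Om where
  onSort s := (d.onSort s).flatMap e.onSort
  onOp {w _} σ := fun x v =>
    (flatten e.onSort (fun t i => e.sharp (w.flatMap d.onSort) (d.onOp σ t i)) x v).rename
      (fun _ => Down.cast List.flatMap_assoc)

theorem comp_onOp_join (d : Polyderivor Sg Lm) (e : Polyderivor Lm Om) {w : List Sg.sorts}
    {s : Sg.sorts} (σ : Sg.Op w s) {t : Lm.sorts} {x : Om.sorts} (i : Down (d.onSort s) t)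
    (k : Down (e.onSort t) x) :
    (d.comp e).onOp σ x (join e.onSort i k) =
      (e.sharp _ (d.onOp σ t i) x k).rename (fun _ => Down.cast List.flatMap_assoc) := by
  simp [comp]

/-- Evaluation of a derived family of terms. -/
theorem eval_sharp (e : Polyderivor Sg Lm) (C : Alg Lm) {u : List Sg.sorts} {t : Sg.sorts}
    (P : Term Sg (Down u) t) (v : Pow C.carrier (u.flatMap e.onSort)) {x : Lm.sorts}
    (k : Down (e.onSort t) x) :
    (e.sharp u P x k).eval C v =
      P.eval (e.pullAlg C) (fun _ i _ j => v _ (join e.onSort i j)) x k := by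
  have := hom_eval (e.pullMap (evalHom C v)) (fun _ i _ j => .var (join e.onSort i j)) P
  exact congrFun (congrFun this x) k

theorem eval_sharp_flatten (e : Polyderivor Sg Lm) (C : Alg Lm) {u : List Sg.sorts} {t : Sg.sorts}
    (P : Term Sg (Down u) t) (b : Pow (e.pullAlg C).carrier u) {x : Lm.sorts}
    (k : Down (e.onSort t) x) :
    (e.sharp u P x k).eval C (flatten e.onSort b) = P.eval (e.pullAlg C) b x k := by
  rw [eval_sharp]
  simp only [flatten_join]

/-- The homomorphism `ι` from `d*(e*(C))` to `(e ∘ d)*(C)`. -/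
noncomputable def flattenHom (d : Polyderivor Sg Lm) (e : Polyderivor Lm Om) (C : Alg Om) :
    d.pullAlg (e.pullAlg C) ⟶ (d.comp e).pullAlg C where
  toFun _ a := flatten e.onSort a
  map_op {w s} σ a := by
    apply pow_flatMap_ext
    intro t i x k
    show flatten e.onSort (fun t j => (d.onOp σ t j).eval (e.pullAlg C) (flatten d.onSort a)) x
        (join e.onSort i k) =
      ((d.comp e).onOp σ x (join e.onSort i k)).eval C
        (flatten (fun s => (d.onSort s).flatMap e.onSort) (fun s i => flatten e.onSort (a s i)))
    rw [flatten_join, comp_onOp_join, eval_rename, ← eval_sharp_flatten, flatten_flatten]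

/-- The homomorphism from `id*(A)` to `A`. -/
def idHom (A : Alg Sg) : (idPd Sg).pullAlg A ⟶ A where
  toFun s a := a s (Down.here s)
  map_op {w s} σ a := by
    show A.op σ (fun t i => flatten (fun s => [s]) a t
      (Down.cast (flatMap_singletons w).symm i)) = _
    congr 1
    funext t i
    have : Down.cast (flatMap_singletons w).symm i = join (fun s => [s]) i (Down.here t) :=
      (congrArg (Down.cast (flatMap_singletons w).symm) (join_singletons i)).symm
    rw [this, flatten_join]

theorem sharp_comp (d : Polyderivor Sg Lm) (e : Polyderivor Lm Om) {u : List Sg.sorts}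
    {s : Sg.sorts} (P : Term Sg (Down u) s) {t : Lm.sorts} {x : Om.sorts}
    (i : Down (d.onSort s) t) (k : Down (e.onSort t) x) :
    (d.comp e).sharp u P x (join e.onSort i k) =
      (e.sharp _ (d.sharp u P t i) x k).rename (fun _ => Down.cast List.flatMap_assoc) := by
  have := hom_eval (flattenHom d e (Alg.free Om (Down (u.flatMap (d.comp e).onSort))))
    (X := Down u)
    (fun s i t j x k => .var (join (d.comp e).onSort i (join e.onSort j k))) P
  have h2 := congrFun (congrFun this x) (join e.onSort i k)
  have h3 : (fun (s : Sg.sorts) (i : Down u s) =>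
      (flattenHom d e (Alg.free Om (Down (u.flatMap (d.comp e).onSort)))).toFun s
        (fun t j x k => .var (join (d.comp e).onSort i (join e.onSort j k)))) =
      fun s i x l => .var (join (d.comp e).onSort i l) := by
    funext s i
    apply pow_flatMap_ext
    intro t j x k
    exact flatten_join e.onSort
      (B := Term Om (Down (u.flatMap (d.comp e).onSort)))
      (fun t j x k => .var (join (d.comp e).onSort i (join e.onSort j k))) j k
  rw [h3] at h2
  have h5 : ∀ (s : Sg.sorts) (i : Down u s),
      flatten e.onSort (fun t j x k => .var (join (d.comp e).onSort i (join e.onSort j k))) =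
        fun x l => Term.var (Sg := Om) (join (d.comp e).onSort i l) := by
    intro s i
    apply pow_flatMap_ext
    intro t j x k
    rw [flatten_join]
  have h6 : flatten (B := Term Om (Down (u.flatMap (d.comp e).onSort))) (d.comp e).onSort
      (fun s i x l => .var (join (d.comp e).onSort i l)) = fun x v => .var v := by
    apply pow_flatMap_ext
    intro t j x k
    rw [flatten_join]
  refine h2.symm.trans ?_
  refine (flatten_join _ _ _ _).trans ?_
  have h4 := eval_sharp_flatten d (e.pullAlg (Alg.free Om (Down (u.flatMap (d.comp e).onSort))))
    P (fun s i t j x k => .var (join (d.comp e).onSort i (join e.onSort j k))) i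
  rw [← h4, ← eval_sharp_flatten, flatten_flatten]
  simp only [h5, h6]
  rfl

theorem rename_cast_sharp (d : Polyderivor Sg Lm) {u u' : List Sg.sorts} (h : u = u')
    {s : Sg.sorts} (P : Term Sg (Down u) s) {t : Lm.sorts} (j : Down (d.onSort s) t) :
    d.sharp u' (P.rename (fun _ => Down.cast h)) t j =
      (d.sharp u P t j).rename (fun _ => Down.cast (by rw [h])) := by
  subst h
  exact (congrArg (fun P => d.sharp u P t j) (rename_id P)).trans (rename_id _).symm

theorem sharp_id {u : List Sg.sorts} {s : Sg.sorts} (P : Term Sg (Down u) s) :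
    (idPd Sg).sharp u P s (Down.here s) =
      P.rename (fun _ => Down.cast (flatMap_singletons u).symm) := by
  refine (hom_eval (idHom _) _ P).trans ?_
  unfold Term.rename Term.bind
  congr 1
  funext s i
  show Term.var (join _ i _) = Term.var _
  congr 1
  exact congrArg (Down.cast (flatMap_singletons u).symm) (join_singletons i)

theorem id_comp' (d : Polyderivor Sg Lm) : (idPd Sg).comp d = d := by
  refine ext' (fun s => flatMap_one _ s) ?_
  intro w s σ t j
  obtain ⟨r, i, j, rfl⟩ := exists_join _ j
  obtain ⟨e, rfl⟩ := i.singleton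
  subst e
  rw [comp_onOp_join, rename_rename, join_here]
  have h6 : flatten (B := Term Lm (Down ((w.flatMap fun s => [s]).flatMap d.onSort))) d.onSort
      (fun t i x k =>
        .var (join d.onSort (Down.cast (flatMap_singletons w).symm i) k)) =
      fun x v => .var (Down.cast (by rw [flatMap_singletons w]) v) := by
    apply pow_flatMap_ext
    intro t i x k
    rw [flatten_join]
    congr 1
    exact join_cast d.onSort (flatMap_singletons w).symm i k
  show (Term.eval (Alg.free Lm _) (flatten d.onSort (fun t i x k =>
    .var (join d.onSort (Down.cast (flatMap_singletons w).symm i) k))) (d.onOp σ t j)).rename _ = _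
  rw [h6]
  exact (rename_rename _ _ _).trans (rename_id _)

theorem comp_id' (d : Polyderivor Sg Lm) : d.comp (idPd Lm) = d := by
  refine ext' (fun s => flatMap_singletons _) ?_
  intro w s σ t j
  obtain ⟨r, j, i, rfl⟩ := exists_join _ j
  obtain ⟨e, rfl⟩ := i.singleton
  subst e
  rw [comp_onOp_join, rename_rename, join_singletons]
  show (((idPd Lm).sharp _ _ _ (Down.here _))).rename _ = _
  rw [sharp_id, rename_rename]
  exact rename_id _

theorem assoc' (d : Polyderivor Sg Lm) (e : Polyderivor Lm Om) (h : Polyderivor Om Th) :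
    (d.comp e).comp h = d.comp (e.comp h) := by
  refine ext' (fun s => List.flatMap_assoc) ?_
  intro w s σ y l
  obtain ⟨x, v, l, rfl⟩ := exists_join _ l
  obtain ⟨t, i, k, rfl⟩ := exists_join _ v
  rw [comp_onOp_join, comp_onOp_join, join_assoc, comp_onOp_join, sharp_comp, rename_cast_sharp]
  simp only [rename_rename, Down.cast_cast]

end Polyderivor

/-- The category `Sig_pd` of signatures and polyderivors. -/
noncomputable instance sigCategory : Category.{u} Signature.{u} where
  Hom := Polyderivor
  id := Polyderivor.idPd
  comp := Polyderivor.comp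
  id_comp := Polyderivor.id_comp'
  comp_id := Polyderivor.comp_id'
  assoc := Polyderivor.assoc'

@[simp] theorem sig_id_onSort (Sg : Signature.{u}) (s : Sg.sorts) :
    Polyderivor.onSort (𝟙 Sg) s = [s] := rfl

@[simp] theorem sig_comp_onSort {Sg Lm Om : Signature.{u}} (d : Sg ⟶ Lm) (e : Lm ⟶ Om)
    (s : Sg.sorts) : Polyderivor.onSort (d ≫ e) s =
      (Polyderivor.onSort d s).flatMap (Polyderivor.onSort e) := rfl

/-- The objects of `Ter(Σ)`: sorted sets, thought of as sets of variables. -/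
@[ext]
structure Ter (Sg : Signature.{u}) where
  /-- the sorted set -/
  vars : Sg.sorts → Type u

/-- The category `Ter(Σ)`, the dual of the Kleisli category of the monad of terms: a morphism from
`X` to `Y` is a `Y`-indexed family of terms with variables in `X`, and composition is
substitution. -/
instance terCategory (Sg : Signature.{u}) : Category.{u} (Ter Sg) where
  Hom X Y := ∀ s, Y.vars s → Term Sg X.vars s
  id X := fun _ x => .var x
  comp P Q := fun s z => (Q s z).bind P
  id_comp P := by
    funext s y
    exact eval_free_var _
  comp_id P := rfl
  assoc P Q R := by
    funext s y
    exact (eval_bind _ _ _ _).symm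

theorem ter_comp {Sg : Signature.{u}} {X Y Z : Ter Sg} (P : X ⟶ Y) (Q : Y ⟶ Z) (s : Sg.sorts)
    (z : Z.vars s) : (P ≫ Q) s z = (Q s z).bind P := rfl

theorem ter_id {Sg : Signature.{u}} (X : Ter Sg) (s : Sg.sorts) (x : X.vars s) :
    (𝟙 X : X ⟶ X) s x = .var x := rfl

/-- The morphism of `Ter(Σ)` given by a mapping of variables. -/
def ren {Sg : Signature.{u}} {X Y : Ter Sg} (f : ∀ s, Y.vars s → X.vars s) : X ⟶ Y :=
  fun s y => .var (f s y)

theorem ren_comp {Sg : Signature.{u}} {X Y Z : Ter Sg} (f : ∀ s, Y.vars s → X.vars s)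
    (g : ∀ s, Z.vars s → Y.vars s) :
    (ren f : X ⟶ Y) ≫ (ren g : Y ⟶ Z) = ren (fun s z => f s (g s z)) := rfl

/-- The isomorphism of `Ter(Σ)` given by a bijection of variables. -/
def renIso {Sg : Signature.{u}} {X Y : Ter Sg} (e : ∀ s, Y.vars s ≃ X.vars s) : X ≅ Y where
  hom := ren (fun s => e s)
  inv := ren (fun s => (e s).symm)
  hom_inv_id := by
    rw [ren_comp]
    simp only [Equiv.apply_symm_apply]
    rfl
  inv_hom_id := by
    rw [ren_comp]
    simp only [Equiv.symm_apply_apply]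
    rfl

namespace Polyderivor

variable {Sg Lm Om Th : Signature.{u}}

/-- The sorted set `∐†_φ X` of all `(s, x, j)` with `x ∈ X_s` and `j` a variable of `↓φ(s)`. -/
abbrev coprod (d : Polyderivor Sg Lm) (X : Ter Sg) : Ter Lm :=
  ⟨fun t => Σ s, X.vars s × Down (d.onSort s) t⟩

/-- The bijection `θ` from `Hom(∐†_φ X, B)` to `Hom(X, (B_{φ(s)})_s)`. -/
def theta (d : Polyderivor Sg Lm) (X : Ter Sg) (B : Lm.sorts → Type u) :
    (∀ t, (d.coprod X).vars t → B t) ≃ (∀ s, X.vars s → Pow B (d.onSort s)) where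
  toFun h s x t j := h t ⟨s, x, j⟩
  invFun k t p := k p.1 p.2.1 t p.2.2
  left_inv _ := rfl
  right_inv _ := rfl

/-- The homomorphism `η^d_X` from `T_Σ(X)` to `d*(T_Λ(∐†_φ X))` which extends the image under `θ`
of the insertion of the variables. -/
noncomputable def eta (d : Polyderivor Sg Lm) (X : Ter Sg) :
    Alg.free Sg X.vars ⟶ d.pullAlg (Alg.free Lm (d.coprod X).vars) :=
  evalHom _ (d.theta X _ (fun _ v => .var v))

/-- The action of `d_⋄` on morphisms: `θ⁻¹` of the composite of `P` and `η^d_X`. -/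
noncomputable def pushMap (d : Polyderivor Sg Lm) {X Y : Ter Sg} (P : X ⟶ Y) :
    d.coprod X ⟶ d.coprod Y :=
  (d.theta Y (Term Lm (d.coprod X).vars)).symm (fun s y => (d.eta X).toFun s (P s y))

/-- Evaluation of a translated term. -/
theorem eval_eta (d : Polyderivor Sg Lm) (C : Alg Lm) {X : Ter Sg}
    (v : ∀ t, (d.coprod X).vars t → C.carrier t) {s : Sg.sorts} (P : Term Sg X.vars s)
    {t : Lm.sorts} (j : Down (d.onSort s) t) :
    (AlgHom.toFun (d.eta X) s P t j).eval C v =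
      P.eval (d.pullAlg C) (d.theta X _ v) t j := by
  have := hom_eval (d.pullMap (evalHom C v)) (d.theta X _ (fun _ v => .var v)) P
  exact congrFun (congrFun this t) j

/-- The functor `d_⋄` from `Ter(Σ)` to `Ter(Λ)`. -/
noncomputable def push (d : Polyderivor Sg Lm) : Ter Sg ⥤ Ter Lm where
  obj := d.coprod
  map := d.pushMap
  map_id X := rfl
  map_comp {X Y Z} P Q := by
    funext t z
    obtain ⟨s, z, j⟩ := z
    show (AlgHom.toFun (d.eta X) s ((Q s z).bind P) t j) =
      (AlgHom.toFun (d.eta Y) s (Q s z) t j).eval (Alg.free Lm (d.coprod X).vars) (d.pushMap P)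
    rw [eval_eta]
    have := hom_eval (d.eta X) (X := Y.vars) P (Q s z)
    exact congrFun (congrFun this t) j

theorem push_ren (d : Polyderivor Sg Lm) {X Y : Ter Sg} (f : ∀ s, Y.vars s → X.vars s) :
    d.push.map (ren f : X ⟶ Y) = 
      ren (X := d.coprod X) (Y := d.coprod Y) (fun _ p => ⟨p.1, f _ p.2.1, p.2.2⟩) := rfl

/-- The natural isomorphism from `(e ∘ d)*` to `d* ∘ e*`. -/
noncomputable def pullComp (d : Sg ⟶ Lm) (e : Lm ⟶ Om) :
    pull (d ≫ e) ≅ pull e ⋙ pull d :=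
  NatIso.ofComponents
    (fun C => (Alg.isoMk (flattenHom d e C)
      (fun s => flattenEquiv (Polyderivor.onSort e) C.carrier (Polyderivor.onSort d s))
      (fun _ _ => rfl)).symm)
    (fun _ => rfl)

/-- The natural isomorphism from `id*` to the identity. -/
noncomputable def pullId (Sg : Signature.{u}) : pull (𝟙 Sg) ≅ 𝟭 (Alg Sg) :=
  NatIso.ofComponents
    (fun A => Alg.isoMk (idHom A) (fun s => (singleEquiv A.carrier s).symm) (fun _ _ => rfl))
    (fun _ => rfl)

/-- The bijection between `∐†_ψ ∐†_φ X` and `∐†_{ψ♯ ∘ φ} X`. -/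
noncomputable def coprodComp (d : Sg ⟶ Lm) (e : Lm ⟶ Om) (X : Ter Sg) (x : Om.sorts) :
    (coprod e (coprod d X)).vars x ≃ (coprod (d ≫ e) X).vars x where
  toFun p := ⟨p.2.1.1, p.2.1.2.1, join (Polyderivor.onSort e) p.2.1.2.2 p.2.2⟩
  invFun p :=
    let q := (joinEquiv (Polyderivor.onSort e) (Polyderivor.onSort d p.1) x).symm p.2.2
    ⟨q.1, ⟨p.1, p.2.1, q.2.1⟩, q.2.2⟩
  left_inv p := by
    obtain ⟨t, ⟨s, x, i⟩, j⟩ := p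
    have : (joinEquiv (Polyderivor.onSort e) (Polyderivor.onSort d s) _).symm
        (join (Polyderivor.onSort e) i j) = ⟨t, i, j⟩ :=
      (Equiv.symm_apply_eq _).2 rfl
    dsimp only
    rw [this]
  right_inv p := by
    obtain ⟨s, x, j⟩ := p
    have := (joinEquiv (Polyderivor.onSort e) (Polyderivor.onSort d s) _).apply_symm_apply j
    exact congrArg (fun j => (⟨s, x, j⟩ : (coprod (d ≫ e) X).vars _)) this

/-- The bijection between `X` and `∐†_{s ↦ (s)} X`. -/
def coprodId (X : Ter Sg) (s : Sg.sorts) : X.vars s ≃ (coprod (𝟙 Sg) X).vars s where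
  toFun x := ⟨s, x, Down.here s⟩
  invFun p := p.2.2.singleton.choose ▸ p.2.1
  left_inv _ := rfl
  right_inv p := by
    obtain ⟨s, x, j⟩ := p
    obtain ⟨e, rfl⟩ := Down.singleton j
    subst e
    rfl

/-- The natural isomorphism from `(e ∘ d)_⋄` to `e_⋄ ∘ d_⋄`. -/
noncomputable def pushComp (d : Sg ⟶ Lm) (e : Lm ⟶ Om) :
    push (d ≫ e) ≅ push d ⋙ push e :=
  NatIso.ofComponents (fun X => renIso (coprodComp d e X)) (by
    intro X Y P
    funext x p
    obtain ⟨t, ⟨s, y, i⟩, k⟩ := p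
    show (AlgHom.toFun (eta (d ≫ e) X) s (P s y) x (join _ i k)) =
      (AlgHom.toFun (eta e (coprod d X)) t (AlgHom.toFun (eta d X) s (P s y) t i) x k).bind
        (fun _ p => .var (coprodComp d e X _ p))
    have h1 := eval_eta e (Alg.free Om (coprod (d ≫ e) X).vars)
      (fun _ p => .var (coprodComp d e X _ p)) (AlgHom.toFun (eta d X) s (P s y) t i) k
    have h2 := eval_eta d (pullAlg e (Alg.free Om (coprod (d ≫ e) X).vars))
      (theta e _ _ (fun _ p => .var (coprodComp d e X _ p))) (P s y) i
    have h3 := hom_eval (flattenHom d e (Alg.free Om (coprod (d ≫ e) X).vars))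
      (theta d X _ (theta e _ _ (fun _ p => .var (coprodComp d e X _ p)))) (P s y)
    have h4 : (fun (s : Sg.sorts) (x : X.vars s) =>
        AlgHom.toFun (flattenHom d e (Alg.free Om (coprod (d ≫ e) X).vars)) s
        (theta d X _ (theta e _ _ (fun _ p => .var (coprodComp d e X _ p))) s x)) =
        theta (d ≫ e) X _ (fun _ v => .var v) := by
      funext s x
      apply pow_flatMap_ext
      intro t i y k
      exact flatten_join (Polyderivor.onSort e) (B := Term Om (coprod (d ≫ e) X).vars)
        (fun t i y k => .var (coprodComp d e X y ⟨t, ⟨s, x, i⟩, k⟩)) i k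
    rw [h4] at h3
    refine Eq.trans ?_ ((congrFun (congrFun h2 x) k).symm.trans h1.symm)
    exact (congrFun (congrFun h3.symm x) (join _ i k)).trans (flatten_join _ _ _ _))

/-- The natural isomorphism from `id_⋄` to the identity. -/
noncomputable def pushId (Sg : Signature.{u}) : push (𝟙 Sg) ≅ 𝟭 (Ter Sg) :=
  NatIso.ofComponents (fun X => renIso (coprodId X)) (by
    intro X Y P
    funext s y
    show AlgHom.toFun (eta (𝟙 Sg) X) s (P s y) s (Down.here s) = (P s y).bind _
    refine (hom_eval (idHom _) _ (P s y)).trans rfl)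

end Polyderivor

open Polyderivor

theorem pull_eqToHom {Sg Lm : Signature.{u}} {d e : Sg ⟶ Lm} (h : d = e)
    (h' : (pull d).toCatHom = (pull e).toCatHom) (C : Alg Lm) (s : Sg.sorts)
    (a : Pow C.carrier (onSort d s)) :
    AlgHom.toFun ((eqToHom h').toNatTrans.app C) s a =
      fun t j => a t (Down.cast (by rw [h]) j) := by
  subst h
  rfl

theorem push_eqToHom {Sg Lm : Signature.{u}} {d e : Sg ⟶ Lm} (h : d = e)
    (h' : (push d).toCatHom = (push e).toCatHom) (X : Ter Sg) (t : Lm.sorts)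
    (p : (coprod e X).vars t) :
    (eqToHom h').toNatTrans.app X t p =
      .var (X := (coprod d X).vars) ⟨p.1, p.2.1, Down.cast (by rw [h]) p.2.2⟩ := by
  subst h
  rfl

/-- The pseudo-functor `Alg_pd`. -/
noncomputable def AlgPd : LocallyDiscrete Signature.{u}ᵒᵖ ⥤ᵖ Cat.{u, u + 1} :=
  LocallyDiscrete.mkPseudofunctor
    (fun Sg => Cat.of (Alg Sg.unop))
    (fun d => (pull d.unop).toCatHom)
    (fun Sg => Cat.Hom.isoMk (pullId Sg.unop))
    (fun d e => Cat.Hom.isoMk (pullComp e.unop d.unop))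
    (by
      intro Th Om Lm Sg h e d
      ext C
      apply alg_hom_ext
      intro s a
      refine Eq.trans ?_ (pull_eqToHom (by simp) _ C s a).symm
      apply pow_flatMap_ext
      intro x v y l
      obtain ⟨t, i, k, rfl⟩ := exists_join _ v
      show flatten (onSort h.unop) (flatten (onSort e.unop) (fun t i x k y l =>
        a y (join (fun t => (onSort e.unop t).flatMap (onSort h.unop)) i
          (join (onSort h.unop) k l)))) y (join _ (join _ i k) l) = _
      rw [flatten_join, flatten_join, join_assoc])
    (by
      intro Sg Lm d
      ext C
      apply alg_hom_ext
      intro s a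
      refine Eq.trans ?_ (pull_eqToHom (by simp) _ C s a).symm
      funext t j
      show a t (join _ j (Down.here _)) = a t _
      congr 1
      exact congrArg (Down.cast (flatMap_singletons _).symm) (join_singletons j))
    (by
      intro Sg Lm d
      ext C
      apply alg_hom_ext
      intro s a
      refine Eq.trans ?_ (pull_eqToHom (by simp) _ C s a).symm
      funext t j
      show a t (join _ (Down.here _) j) = a t _
      congr 1
      exact congrArg (Down.cast (flatMap_one _ _).symm) (join_here _ j))

/-- The pseudo-functor `Ter_pd`. -/
noncomputable def TerPd : LocallyDiscrete Signature.{u} ⥤ᵖ Cat.{u, u + 1} :=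
  LocallyDiscrete.mkPseudofunctor
    (fun Sg => Cat.of (Ter Sg))
    (fun d => (push d).toCatHom)
    (fun Sg => Cat.Hom.isoMk (pushId Sg))
    (fun d e => Cat.Hom.isoMk (pushComp d e))
    (by
      intro Th Om Lm Sg h e d
      ext X
      funext x p
      refine Eq.trans ?_ (push_eqToHom (by simp) _ X x p).symm
      obtain ⟨s, a, j⟩ := p
      obtain ⟨y, i, l, rfl⟩ := exists_join _ j
      obtain ⟨z, l, m, rfl⟩ := exists_join _ l
      show Term.var _ = Term.var _
      congr 1
      have e1 : (coprodComp h (e ≫ d) X x).symm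
          ⟨s, a, join (onSort (e ≫ d)) i (join (onSort d) l m)⟩ =
            ⟨y, ⟨s, a, i⟩, join (onSort d) l m⟩ :=
        (Equiv.symm_apply_eq _).2 rfl
      have e2 : (coprodComp e d (coprod h X) x).symm ⟨y, ⟨s, a, i⟩, join (onSort d) l m⟩ =
          ⟨z, ⟨y, ⟨s, a, i⟩, l⟩, m⟩ :=
        (Equiv.symm_apply_eq _).2 rfl
      show (fun q : (coprod d (coprod e (coprod h X))).vars x =>
        coprodComp (h ≫ e) d X x ⟨q.1, coprodComp h e X q.1 q.2.1, q.2.2⟩)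
          ((coprodComp e d (coprod h X) x).symm ((coprodComp h (e ≫ d) X x).symm
            ⟨s, a, join (onSort (e ≫ d)) i (join (onSort d) l m)⟩)) = _
      rw [e1, e2]
      show (⟨s, a, join _ (join _ i l) m⟩ : (coprod ((h ≫ e) ≫ d) X).vars x) = ⟨s, a, _⟩
      congr 2
      exact congrArg (Down.cast (List.flatMap_assoc).symm) (join_assoc _ _ i l m))
    (by
      intro Sg Lm d
      ext X
      funext t p
      refine Eq.trans ?_ (push_eqToHom (by simp) _ X t p).symm
      obtain ⟨s, a, j⟩ := p
      show Term.var (X := (coprod (𝟙 Sg ≫ d) X).vars) ⟨s, a, join _ (Down.here _) j⟩ = Term.var _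
      congr 3
      exact congrArg (Down.cast (flatMap_one _ _).symm) (join_here _ j))
    (by
      intro Sg Lm d
      ext X
      funext t p
      refine Eq.trans ?_ (push_eqToHom (by simp) _ X t p).symm
      obtain ⟨s, a, j⟩ := p
      show Term.var (X := (coprod (d ≫ 𝟙 Lm) X).vars) ⟨s, a, join _ j (Down.here _)⟩ = Term.var _
      congr 3
      exact congrArg (Down.cast (flatMap_singletons _).symm) (join_singletons j))

/-- The functor `Tr^Σ` from `Alg(Σ) × Ter(Σ)` to the category of sets. It sends `(A, X)` to the set
`A_X` of the valuations of `X` in `A`, and `(f, P)`, where `P` is a morphism from `X` to `Y`, to the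
mapping from `A_X` to `B_Y` which sends `u` to `f ∘ u♯ ∘ P`. -/
def Tr (Sg : Signature.{u}) : Alg Sg × Ter Sg ⥤ Type u where
  obj p := ∀ s, p.2.vars s → p.1.carrier s
  map {p q} g := ↾ fun (v : ∀ s, p.2.vars s → p.1.carrier s) s (y : q.2.vars s) =>
    AlgHom.toFun g.1 s ((g.2 s y).eval p.1 v)
  map_id p := rfl
  map_comp {p q r} g h := by
    ext v s z
    show AlgHom.toFun h.1 s (AlgHom.toFun g.1 s (((h.2 s z).bind g.2).eval p.1 v)) =
      AlgHom.toFun h.1 s ((h.2 s z).eval q.1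
        (fun s y => AlgHom.toFun g.1 s ((g.2 s y).eval p.1 v)))
    rw [eval_bind, hom_eval]

section Institutions

universe v₁ u₁ v₂ u₂ w₃ v₃ u₃

variable {C : Type u₁} [Category.{v₁} C]

theorem map₂_loc {D : Type u₃} [Bicategory.{w₃, v₃} D] (F : LocallyDiscrete C ⥤ᵖ D)
    {a b : LocallyDiscrete C} {f g : a ⟶ b} (η : f ⟶ g) :
    F.map₂ η = eqToHom (by rw [LocallyDiscrete.eq_of_hom η]) := by
  obtain rfl := LocallyDiscrete.eq_of_hom η
  rw [Subsingleton.elim η (𝟙 f), F.map₂_id]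
  rfl

theorem prod_eqToHom_app {A A' B B' : Cat.{v₂, u₂}} {F F' : A ⟶ A'} {G G' : B ⟶ B'}
    (hF : F = F') (hG : G = G')
    (h : (F.toFunctor.prod G.toFunctor).toCatHom = (F'.toFunctor.prod G'.toFunctor).toCatHom)
    (p : A × B) :
    (eqToHom h).toNatTrans.app p =
      ((eqToHom hF).toNatTrans.app p.1, (eqToHom hG).toNatTrans.app p.2) := by
  subst hF hG
  rfl

/-- The pseudo-functor `Mod(·) × Sen(·)`. -/
def prodPseudo (Mod : LocallyDiscrete Cᵒᵖ ⥤ᵖ Cat.{v₂, u₂}) (Sen : LocallyDiscrete C ⥤ᵖ Cat.{v₂, u₂}) :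
    LocallyDiscrete (Cᵒᵖ × C) ⥤ᵖ Cat.{v₂, u₂} :=
  LocallyDiscrete.mkPseudofunctor
    (fun p => Cat.of (Mod.obj ⟨p.1⟩ × Sen.obj ⟨p.2⟩))
    (fun f => ((Mod.map f.1.toLoc).toFunctor.prod (Sen.map f.2.toLoc).toFunctor).toCatHom)
    (fun p => Cat.Hom.isoMk (NatIso.prod (Cat.Hom.toNatIso (Mod.mapId ⟨p.1⟩))
      (Cat.Hom.toNatIso (Sen.mapId ⟨p.2⟩))))
    (fun f g => Cat.Hom.isoMk (NatIso.prod (Cat.Hom.toNatIso (Mod.mapComp f.1.toLoc g.1.toLoc))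
      (Cat.Hom.toNatIso (Sen.mapComp f.2.toLoc g.2.toLoc))))
    (by
      intro _ _ _ _ f g h
      have hM := (Mod.map₂_associator f.1.toLoc g.1.toLoc h.1.toLoc).symm.trans
        (map₂_loc Mod _)
      have hS := (Sen.map₂_associator f.2.toLoc g.2.toLoc h.2.toLoc).symm.trans
        (map₂_loc Sen _)
      ext p
      refine Eq.trans (Prod.ext ?_ ?_) (prod_eqToHom_app (congrArg _ (by simp)) (congrArg _ (by simp)) _ p).symm
      · exact congrArg (fun η => η.toNatTrans.app p.1) hM
      · exact congrArg (fun η => η.toNatTrans.app p.2) hS)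
    (by
      intro _ _ f
      have hM := (Mod.map₂_left_unitor f.1.toLoc).symm.trans (map₂_loc Mod _)
      have hS := (Sen.map₂_left_unitor f.2.toLoc).symm.trans (map₂_loc Sen _)
      ext p
      refine Eq.trans (Prod.ext ?_ ?_)
        (prod_eqToHom_app (congrArg _ (by simp)) (congrArg _ (by simp)) _ p).symm
      · exact congrArg (fun η => η.toNatTrans.app p.1) hM
      · exact congrArg (fun η => η.toNatTrans.app p.2) hS)
    (by
      intro _ _ f
      have hM := (Mod.map₂_right_unitor f.1.toLoc).symm.trans (map₂_loc Mod _)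
      have hS := (Sen.map₂_right_unitor f.2.toLoc).symm.trans (map₂_loc Sen _)
      ext p
      refine Eq.trans (Prod.ext ?_ ?_)
        (prod_eqToHom_app (congrArg _ (by simp)) (congrArg _ (by simp)) _ p).symm
      · exact congrArg (fun η => η.toNatTrans.app p.1) hM
      · exact congrArg (fun η => η.toNatTrans.app p.2) hS)

variable {D : Type u₃} [Bicategory.{w₃, v₃} D]

/-- The 1-cell `F(f, g)`, for a pseudo-functor `F` on `Cᵒᵖ × C`. -/
abbrev biMap (F : LocallyDiscrete (Cᵒᵖ × C) ⥤ᵖ D) {a a' b b' : C} (f : a' ⟶ a) (g : b ⟶ b') :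
    F.obj ⟨(.op a, b)⟩ ⟶ F.obj ⟨(.op a', b')⟩ :=
  F.map (Quiver.Hom.toLoc ((f.op, g) : ((.op a, b) : Cᵒᵖ × C) ⟶ (.op a', b')))

/-- The structural isomorphism between `F(h, k)` and `F(f', g') ∘ F(f, g)`, for `h = f ∘ f'` and
`k = g' ∘ g`. -/
abbrev biMapComp (F : LocallyDiscrete (Cᵒᵖ × C) ⥤ᵖ D) {a a' a'' b b' b'' : C}
    (f : a' ⟶ a) (g : b ⟶ b') (f' : a'' ⟶ a') (g' : b' ⟶ b'') (h : a'' ⟶ a) (k : b ⟶ b'')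
    (hh : f' ≫ f = h) (hk : g ≫ g' = k) : biMap F h k ≅ biMap F f g ≫ biMap F f' g' :=
  F.mapComp' _ _ _ (by subst hh hk; rfl)

/-- The structural isomorphism between `F(1, 1)` and the identity. -/
abbrev biMapId (F : LocallyDiscrete (Cᵒᵖ × C) ⥤ᵖ D) (c : C) :
    biMap F (𝟙 c) (𝟙 c) ≅ 𝟙 (F.obj ⟨(.op c, c)⟩) :=
  F.mapId ⟨(.op c, c)⟩

/-- The conditions under which a family `α` of 1-cells `α_c : F(c, c) ⟶ V` and a family `β` of
invertible 2-cells `β_f` from `α_c ∘ F(f, 1)` to `α_{c'} ∘ F(1, f)` form a pseudo-extranatural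
transformation from a pseudo-functor `F`, defined on `Cᵒᵖ × C` for an ordinary category `C`, to the
functor that is constantly `V`. The only 2-cells of `C` are the identities, for which the
compatibility with 2-cells holds trivially. -/
structure IsPseudoExtranatural (F : LocallyDiscrete (Cᵒᵖ × C) ⥤ᵖ D) (V : D)
    (α : ∀ c : C, F.obj ⟨(.op c, c)⟩ ⟶ V)
    (β : ∀ {c c' : C} (f : c ⟶ c'), biMap F f (𝟙 c) ≫ α c ≅ biMap F (𝟙 c') f ≫ α c') :
    Prop where
  /-- compatibility with the composition: the 2-cell from `α_c ∘ F(f, 1) ∘ F(g, 1)` to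
  `α_{c''} ∘ F(1, g) ∘ F(1, f)` obtained by pasting `β_f` and `β_g` along the isomorphism between
  `F(1, f) ∘ F(g, 1)` and `F(g, 1) ∘ F(1, f)` is `β_{g ∘ f}`, up to the structural isomorphisms
  of `F` -/
  comp {c c' c'' : C} (f : c ⟶ c') (g : c' ⟶ c'') :
    biMap F g (𝟙 c) ◁ (β f).hom ≫
      (α_ (biMap F g (𝟙 c)) (biMap F (𝟙 c') f) (α c')).inv ≫
      ((biMapComp F g (𝟙 c) (𝟙 c') f g f (by simp) (by simp)).inv ≫
        (biMapComp F (𝟙 c'') f g (𝟙 c') g f (by simp) (by simp)).hom) ▷ α c' ≫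
      (α_ (biMap F (𝟙 c'') f) (biMap F g (𝟙 c')) (α c')).hom ≫
      biMap F (𝟙 c'') f ◁ (β g).hom ≫
      (α_ (biMap F (𝟙 c'') f) (biMap F (𝟙 c'') g) (α c'')).inv ≫
      (biMapComp F (𝟙 c'') f (𝟙 c'') g (𝟙 c'') (f ≫ g) (by simp) rfl).inv ▷ α c'' =
    (α_ (biMap F g (𝟙 c)) (biMap F f (𝟙 c)) (α c)).inv ≫
      (biMapComp F g (𝟙 c) f (𝟙 c) (f ≫ g) (𝟙 c) rfl (by simp)).inv ▷ α c ≫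
      (β (f ≫ g)).hom
  /-- compatibility with the identities -/
  unit (c : C) :
    (biMapId F c).inv ▷ α c ≫ (β (𝟙 c)).hom = (biMapId F c).inv ▷ α c

/-- An institution on a category `V`: a category `Sig`, two pseudo-functors
`Mod : Sigᵒᵖ ⥤ᵖ Cat` and `Sen : Sig ⥤ᵖ Cat`, and a pseudo-extranatural transformation `(α, β)` from
`Mod(·) × Sen(·)` to the functor that is constantly `V`. -/
structure Institution (V : Cat.{v₂, u₂}) where
  /-- the category of signatures -/
  Sig : Type u₁
  [cat : Category.{v₁} Sig]
  /-- the models -/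
  Mod : LocallyDiscrete Sigᵒᵖ ⥤ᵖ Cat.{v₂, u₂}
  /-- the sentences -/
  Sen : LocallyDiscrete Sig ⥤ᵖ Cat.{v₂, u₂}
  /-- the 1-cells of the transformation -/
  α : ∀ c : Sig, (prodPseudo Mod Sen).obj ⟨(.op c, c)⟩ ⟶ V
  /-- the 2-cells of the transformation -/
  β : ∀ {c c' : Sig} (f : c ⟶ c'), biMap (prodPseudo Mod Sen) f (𝟙 c) ≫ α c ≅
    biMap (prodPseudo Mod Sen) (𝟙 c') f ≫ α c'
  isPseudoExtranatural : IsPseudoExtranatural (prodPseudo Mod Sen) V α β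

end Institutions

/-- The functor `Tr^Σ` as a 1-cell from `Alg(Σ) × Ter(Σ)` to the category of sets. -/
def trCell (Sg : Signature.{u}) :
    (prodPseudo AlgPd TerPd).obj ⟨(.op Sg, Sg)⟩ ⟶ Cat.of (Type u) :=
  (Tr Sg).toCatHom

/-- The type of the natural isomorphisms from `Tr^Λ ∘ (Id × d_⋄)` to `Tr^Σ ∘ (d* × Id)`. -/
abbrev TrIso {Sg Lm : Signature.{u}} (d : Sg ⟶ Lm) :=
  (𝟭 (Alg Lm)).prod (push d) ⋙ Tr Lm ≅ (pull d).prod (𝟭 (Ter Sg)) ⋙ Tr Sg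

/-- A natural isomorphism `θ` from `Tr^Λ ∘ (Id × d_⋄)` to `Tr^Σ ∘ (d* × Id)`, read as a 2-cell from
`Tr^Σ ∘ (d* × id_⋄)` to `Tr^Λ ∘ (id* × d_⋄)`: it is the inverse of `θ`, composed with the structural
isomorphisms between `id_⋄` and `Id` and between `id*` and `Id`. -/
noncomputable def TrIso.cell {Sg Lm : Signature.{u}} {d : Sg ⟶ Lm} (θ : TrIso d) :
    biMap (prodPseudo AlgPd TerPd) d (𝟙 Sg) ≫ trCell Sg ≅
      biMap (prodPseudo AlgPd TerPd) (𝟙 Lm) d ≫ trCell Lm :=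
  Cat.Hom.isoMk (F := (pull d).prod (push (𝟙 Sg)) ⋙ Tr Sg)
      (G := (pull (𝟙 Lm)).prod (push d) ⋙ Tr Lm)
    (Functor.isoWhiskerRight (NatIso.prod (Iso.refl (pull d)) (pushId Sg)) (Tr Sg) ≪≫ θ.symm ≪≫
      Functor.isoWhiskerRight (NatIso.prod (pullId Lm).symm (Iso.refl (push d))) (Tr Lm))

end ManySorted

open ManySorted ManySorted.Polyderivor

namespace ManySorted

open Polyderivor

/-! A valuation of `∐†_φ X` in `A` is a curried form of a valuation of `X` in `d*(A)`, so `θ` is a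
bijection for trivial reasons. Its naturality is one fact about terms, `eval_eta`: evaluating the
translation of a term in `A` under `v` gives the coordinates of the value of the original term in
`d*(A)` under `θ(v)`.

For coherence no further fact about terms is needed. On the term side the structural isomorphisms
only rename variables, on the algebra side they only regroup tuples, and `θ` only curries. Hence
every 2-cell in the two axioms sends a valuation `v` to another one whose entries are entries of `v`
at relabelled positions. `cell_thetaIso_hom_app`, `map_biMapComp_inv_app` and
`map_biMapComp_hom_app` record these relabellings explicitly.

The composition axiom then says that two relabellings agree. A position in `φ(s)` followed by a
position in the block of `ψ` at that letter determines a position in `ψ♯(φ(s))`, and at such a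
position both sides read the same entry of `v`. What remains is bookkeeping for identity
polyderivors, which insert one-letter words on the left or on the right of a position. The identity
axiom holds because a one-letter word has exactly one variable. -/

/-- The natural isomorphism with components `θ_{X,A}`. -/
noncomputable def thetaIso {Sg Lm : Signature.{u}} (d : Sg ⟶ Lm) : TrIso d :=
  NatIso.ofComponents (fun p => (theta d p.2 p.1.carrier).toIso) (by
    intro p q g
    ext v
    funext s y t j
    -- `d*` applies the homomorphism `g.1` coordinate by coordinate, so both sides are an image
    -- under `g.1` and only the two evaluations have to be compared.
    exact congrArg (AlgHom.toFun g.1 t) (eval_eta d p.1 v (g.2 s y) j))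

/-! ### The 2-cells and structural isomorphisms as relabellings of valuations -/

/-- `Here` comes from `id_⋄ ≅ Id`, uncurrying from the inverse of `θ`, and `single` from `Id ≅ id*`.
Only variables are evaluated and all the maps involved compute, so the formula holds by unfolding.
-/
theorem cell_thetaIso_hom_app {Sg Lm : Signature.{u}} (d : Sg ⟶ Lm) (A : Alg Lm) (X : Ter Sg) :
    (thetaIso d).cell.hom.toNatTrans.app (A, X) =
      (↾ fun v t p => single (v p.1 ⟨p.1, p.2.1, Down.here _⟩ t p.2.2) :
        (Tr Sg).obj (pullAlg d A, coprod (𝟙 Sg) X) ⟶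
          (Tr Lm).obj (pullAlg (𝟙 Lm) A, coprod d X)) := by
  rfl

/-- Both `flatten` and the inverse of `coprodComp` find the block of a position by inverting the
bijection `joinEquiv`, which does not compute; they become explicit once the position is given as a
`join`. The positions `j` and `l` are kept free, with equations `hj` and `hl`, because in the
applications they appear as casts of other joins. -/
theorem flatten_coprodComp_symm {a b b' b'' c : Signature.{u}} (f : a ⟶ c) (g : b ⟶ b')
    (g' : b' ⟶ b'')
    {X : Ter b} {B : c.sorts → Type u} {w : List a.sorts} {y : b''.sorts}
    (v : (coprod g' (coprod g X)).vars y → Pow (fun s => Pow B (onSort f s)) w)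
    {s : b.sorts} {x : X.vars s} {r : b'.sorts} {i : Down (onSort g s) r}
    {k : Down (onSort g' r) y} {j : Down (onSort (g ≫ g') s) y} (hj : j = join (onSort g') i k)
    {q : a.sorts} {t : c.sorts} {m : Down w q} {n : Down (onSort f q) t}
    {l : Down (w.flatMap (onSort f)) t} (hl : l = join (onSort f) m n) :
    flatten (onSort f) (v ((coprodComp g g' X y).symm ⟨s, x, j⟩)) t l =
      v ⟨r, ⟨s, x, i⟩, k⟩ q m t n := by
  subst hj hl
  rw [flatten_join, show (coprodComp g g' X y).symm ⟨s, x, join (onSort g') i k⟩ =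
    ⟨r, ⟨s, x, i⟩, k⟩ from (Equiv.symm_apply_eq _).2 rfl]

/-- Whiskering a structural 2-cell with `Tr` makes it act on valuations: tuples of tuples are
flattened, and variables are split along the inverse of `coprodComp`. The composites `h` and `k` are
free because the axioms use the simplified composites, such as `f` in place of `𝟙 ≫ f`; this is the
source of the casts. -/
theorem map_biMapComp_inv_app {a a' b b' c : Signature.{u}}
    (f : a' ⟶ a) (g : b ⟶ b') (f' : c ⟶ a') (g' : b' ⟶ c) (h : c ⟶ a) (k : b ⟶ c)
    (hh : f' ≫ f = h) (hk : g ≫ g' = k) (A : Alg a) (X : Ter b) :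
    (Tr c).map
      ((biMapComp (prodPseudo AlgPd TerPd) f g f' g' h k hh hk).inv.toNatTrans.app (A, X)) =
      (↾ fun v s p _ j => flatten (onSort f)
          (v s ((coprodComp g g' X s).symm ⟨p.1, p.2.1, Down.cast (by rw [hk]) p.2.2⟩)) _
          (Down.cast (by rw [← hh]; rfl) j) :
        (Tr c).obj (pullAlg f' (pullAlg f A), coprod g' (coprod g X)) ⟶
          (Tr c).obj (pullAlg h A, coprod k X)) := by
  -- For literal composites `mapComp'` is `mapComp` and the casts act trivially.
  subst hh hk
  exact (congrArg (fun i : biMap (prodPseudo AlgPd TerPd) (f' ≫ f) (g ≫ g') ≅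
      biMap (prodPseudo AlgPd TerPd) f g ≫ biMap (prodPseudo AlgPd TerPd) f' g' =>
        (Tr c).map (i.inv.toNatTrans.app ((A, X) : Alg a × Ter b)))
    (Pseudofunctor.mapComp'_eq_mapComp (prodPseudo AlgPd TerPd) _ _)).trans rfl

/-- In this direction positions are merged, not split, so the explicit function `join` suffices on
both the algebra side and the term side. -/
theorem map_biMapComp_hom_app {a a' b b' c : Signature.{u}}
    (f : a' ⟶ a) (g : b ⟶ b') (f' : c ⟶ a') (g' : b' ⟶ c) (h : c ⟶ a) (k : b ⟶ c)
    (hh : f' ≫ f = h) (hk : g ≫ g' = k) (A : Alg a) (X : Ter b) :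
    (Tr c).map
      ((biMapComp (prodPseudo AlgPd TerPd) f g f' g' h k hh hk).hom.toNatTrans.app (A, X)) =
      (↾ fun v s p _ i _ l =>
          v s ⟨p.2.1.1, p.2.1.2.1, Down.cast (by rw [← hk]; rfl) (join (onSort g') p.2.1.2.2 p.2.2)⟩
            _ (Down.cast (by rw [← hh]; rfl) (join (onSort f) i l)) :
        (Tr c).obj (pullAlg h A, coprod k X) ⟶
          (Tr c).obj (pullAlg f' (pullAlg f A), coprod g' (coprod g X))) := by
  subst hh hk
  exact (congrArg (fun i : biMap (prodPseudo AlgPd TerPd) (f' ≫ f) (g ≫ g') ≅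
      biMap (prodPseudo AlgPd TerPd) f g ≫ biMap (prodPseudo AlgPd TerPd) f' g' =>
        (Tr c).map (i.hom.toNatTrans.app ((A, X) : Alg a × Ter b)))
    (Pseudofunctor.mapComp'_eq_mapComp (prodPseudo AlgPd TerPd) _ _)).trans rfl

/-! ### Pseudo-extranaturality of term realization -/

theorem isPseudoExtranatural_thetaIso :
    IsPseudoExtranatural (prodPseudo AlgPd.{u} TerPd.{u}) (Cat.of (Type u))
      trCell (fun d => (thetaIso d).cell) where
  comp {c c' c''} f g := by
    ext ⟨A, X⟩
    -- `e₁` to `e₅` are the non-identity factors of the pasted side in order of application: `β_f`,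
    -- the two halves of the interchange of `F(g, 1)` and `F(1, f)`, `β_g`, and the final structural
    -- isomorphism. `e₆` and `e₇` belong to the side of `β_{g ∘ f}`.
    have e₁ := cell_thetaIso_hom_app f (pullAlg g A) (coprod (𝟙 c) X)
    have e₂ := map_biMapComp_inv_app g (𝟙 c) (𝟙 c') f g f (by simp) (by simp) A X
    have e₃ := map_biMapComp_hom_app (𝟙 c'') f g (𝟙 c') g f (by simp) (by simp) A X
    have e₄ := cell_thetaIso_hom_app g (pullAlg (𝟙 c'') A) (coprod f X)
    have e₅ := map_biMapComp_inv_app (𝟙 c'') f (𝟙 c'') g (𝟙 c'') (f ≫ g) (by simp) rfl A X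
    have e₆ := map_biMapComp_inv_app g (𝟙 c) f (𝟙 c) (f ≫ g) (𝟙 c) rfl (by simp) A X
    have e₇ := cell_thetaIso_hom_app (f ≫ g) A X
    -- The factors `𝟙 _` are the components of the associators of `Cat`, which are identities.
    refine (congrArg₂ (· ≫ ·) e₁ (congrArg (𝟙 _ ≫ ·) (congrArg₂ (· ≫ ·)
      (((Tr c').map_comp _ _).trans (congrArg₂ (· ≫ ·) e₂ e₃)) (congrArg (𝟙 _ ≫ ·)
        (congrArg₂ (· ≫ ·) e₄ (congrArg (𝟙 _ ≫ ·) e₅)))))).trans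
      (Eq.trans ?_ (congrArg (𝟙 _ ≫ ·) (congrArg₂ (· ≫ ·) e₆ e₇)).symm)
    refine ConcreteCategory.hom_ext (C := Type u) _ _ fun v => ?_
    funext t p
    obtain ⟨s, x, j⟩ := p
    -- A position of `ψ♯(φ(s))` is the position `k` in the block of the letter at position `i` of
    -- `φ(s)`.
    obtain ⟨r, i, k, rfl⟩ := exists_join _ j
    -- The values lie in the carrier of `id*(A)`, i.e. they are tuples indexed by a one-letter word.
    apply pow_singleton_ext
    -- The side of `β_{g ∘ f}` reads the coordinate `(i, k)` of `v` at the variable `x` wrapped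
    -- twice by the identity polyderivor.
    have hX := flatten_coprodComp_symm g (𝟙 c) (𝟙 c) (v s) (x := x) (i := Down.here s)
      (k := Down.here s) (j := Down.here s) (m := i) (n := k) rfl rfl
    refine Eq.trans ?_ hX.symm
    -- `v₁`, `v₂`, `v₃`, `v₄` are the successive images of `v` under `e₁`, `e₂`, `e₃`, `e₄`.
    let v₁ : ∀ t, (coprod f (coprod (𝟙 c) X)).vars t →
        Pow (fun s => Pow A.carrier (onSort g s)) [t] :=
      fun t p => single (v p.1 ⟨p.1, p.2.1, Down.here _⟩ t p.2.2)
    let v₂ : ∀ t, (coprod f X).vars t → Pow A.carrier (onSort g t) := fun s p _ j =>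
      flatten (onSort g) (v₁ s ((coprodComp (𝟙 c) f X s).symm
        ⟨p.1, p.2.1, Down.cast (flatMap_one _ _).symm p.2.2⟩)) _
        (Down.cast (flatMap_one _ _).symm j)
    let v₃ : ∀ t, (coprod (𝟙 c') (coprod f X)).vars t →
        Pow (fun s => Pow A.carrier [s]) (onSort g t) :=
      fun s p _ i _ l =>
        v₂ s ⟨p.2.1.1, p.2.1.2.1, Down.cast (flatMap_singletons _)
          (join (onSort (𝟙 c')) p.2.1.2.2 p.2.2)⟩ _
          (Down.cast (flatMap_singletons _) (join (onSort (𝟙 c'')) i l))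
    let v₄ : ∀ t, (coprod g (coprod f X)).vars t → Pow (fun s => Pow A.carrier [s]) [t] :=
      fun t p => single (v₃ p.1 ⟨p.1, p.2.1, Down.here _⟩ t p.2.2)
    -- This resolves the outermost factor `e₅`; `v₄` and `v₃` then unfold, since `single` at
    -- `Down.here` and `join` compute.
    refine (flatten_coprodComp_symm (𝟙 c'') f g (v₄ t) (x := x) (i := i) (k := k)
      (m := Down.here t) (n := Down.here t) rfl rfl).trans ?_
    -- The remaining split is that of `e₂`. The factor `e₃` delivers the positions with the
    -- one-letter word inserted on the right (`join i here`, `join k here`), while `e₂` splits them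
    -- with it on the left (`join here i`, `join here k`). Up to casts both are `i`, respectively
    -- `k`, by the two unit laws of `join`.
    exact flatten_coprodComp_symm g (𝟙 c) f (v₁ r) (x := x) (i := Down.here s) (k := i)
      (m := Down.here r) (n := k)
      ((congrArg (Down.cast (flatMap_one _ _).symm) (join_singletons i)).trans
        (congrArg (Down.cast (flatMap_one _ _).symm) (join_here _ i)).symm)
      ((congrArg (Down.cast (flatMap_one _ _).symm) (join_singletons k)).trans
        (congrArg (Down.cast (flatMap_one _ _).symm) (join_here _ k)).symm)
  unit c := by
    ext ⟨A, X⟩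
    -- `β` at an identity has the same source and target and is itself the identity, even before it
    -- is composed with the structural isomorphism.
    have e : (thetaIso (𝟙 c)).cell.hom.toNatTrans.app (A, X) =
        𝟙 ((Tr c).obj (pullAlg (𝟙 c) A, coprod (𝟙 c) X)) := by
      refine (cell_thetaIso_hom_app (𝟙 c) A X).trans ?_
      refine ConcreteCategory.hom_ext (C := Type u) _ _ fun v => ?_
      funext t p
      obtain ⟨s, x, j⟩ := p
      -- The only variable of `(s)` is `Down.here s`, so rebuilding a one-letter tuple from its
      -- single entry gives the tuple back.
      obtain ⟨h, rfl⟩ := j.singleton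
      subst h
      exact pow_singleton_ext rfl
    exact (congrArg (_ ≫ ·) e).trans (Category.comp_id _)

end ManySorted

/-! ### Assembly of the institution -/

theorem proposition62 :
    (∀ Sg Lm : Signature.{u},
      (prodPseudo AlgPd.{u} TerPd.{u}).obj ⟨(.op Sg, Lm)⟩ = Cat.of (Alg Sg × Ter Lm)) ∧
    (∀ {Sg Sg' Lm Lm' : Signature.{u}} (d : Sg' ⟶ Sg) (e : Lm ⟶ Lm'),
      biMap (prodPseudo AlgPd.{u} TerPd.{u}) d e = ((pull d).prod (push e)).toCatHom) ∧
    ∃ θ : ∀ {Sg Lm : Signature.{u}} (d : Sg ⟶ Lm), TrIso d,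
      (∀ {Sg Lm : Signature.{u}} (d : Sg ⟶ Lm) (A : Alg Lm) (X : Ter Sg)
        (h : ∀ t, (coprod d X).vars t → A.carrier t),
        (θ d).hom.app (A, X) h = theta d X A.carrier h) ∧
      ∃ hθ : IsPseudoExtranatural (prodPseudo AlgPd.{u} TerPd.{u}) (Cat.of (Type u))
          trCell (fun d => (θ d).cell),
        ∃ I : Institution.{u, u + 1, u, u + 1} (Cat.of (Type u)),
          I = ⟨Signature.{u}, AlgPd, TerPd, trCell, fun d => (θ d).cell, hθ⟩ :=
  -- The product pseudo-functor has the required values on objects and 1-cells by construction, and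
  -- the components of `thetaIso` are `theta` by definition. The institution is a repackaging of
  -- pseudo-extranaturality, so its witness is read off from the last equation.
  ⟨fun _ _ => rfl, fun _ _ => rfl, thetaIso, fun _ _ _ _ => rfl, isPseudoExtranatural_thetaIso,
    _, rfl⟩
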